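/- Let $\mathcal X$ and $\mathcal Y$ be finite sets, let $L:\mathcal X\times\mathcal Y\to\mathbb R$ be a loss function, and let $\alpha\in(0,1)$. Let $K$ be the set of all pairs $(\mu,\nu)$ of probability vectors $\mu\in\mathbb R^{\mathcal X}$, $\nu\in\mathbb R^{\mathcal Y}$. For $(\mu,\nu)\in K$ let $\Pi(\mu,\nu)$ be the set of probability vectors on $\mathcal X\times\mathcal Y$ with marginals $\mu$ and $\nu$, and let $$V_\alpha(\mu,\nu)=\sup_{\pi\in\Pi(\mu,\nu)}\mathrm{ES}_{\alpha,\pi}(L),\qquad \mathrm{ES}_{\alpha,\pi}(L)=\frac1{1-\alpha}\int_\alpha^1\inf\{x\in\mathbb R:\pi(L\le x)\ge u\}\,du,$$ be the Maximum Expected Shortfall. Fix $x_0\in\mathcal X$ and consider the dual feasible polyhedron, which consists of all $(\varphi,\psi,\rho,\beta)\in\mathbb R^{\mathcal X}\times\mathbb R^{\mathcal Y}\times\mathbb R^{\mathcal X\times\mathcal Y}\times\mathbb R$ such that $\varphi_{x_0}=0$ and, for all $i\in\mathcal X$, $j\in\mathcal Y$, $$(1-\alpha)(\varphi_i+\psi_j)-\rho_{ij}\ge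 0,\qquad \rho_{ij}+\beta\ge L_{ij},\qquad \rho_{ij}\ge 0.$$ This polyhedron has finitely many extreme points $(\varphi^k,\psi^k,\rho^k,\beta^k)$, $k=1,\dots,N_D$, and for all $(\mu,\nu)\in K$ $$V_\alpha(\mu,\nu)=\min_{1\le k\le N_D}\ \varphi^k\cdot\mu+\psi^k\cdot\nu+\beta^k.\qquad(*)$$ Let $I(\mu,\nu)$ be the (nonempty) set of all $k$ that attain the minimum in $(*)$. Then, for every $(\mu,\nu)\in K$: 1. $V_\alpha$ is Hadamard directionally differentiable at $(\mu,\nu)$ tangentially to $K$, with derivative $$V_\alpha'(\mu,\nu;d_\mu,d_\nu)=\min_{k\in I(\mu,\nu)}\ \varphi^k\cdot d_\mu+\psi^k\cdot d_\nu.$$ That is, whenever $(\mu_m,\nu_m)\in K$, $t_m>0$, $t_m\to0$ and $t_m^{-1}\big((\mu_m,\nu_m)-(\mu,\nu)\big)\to(d_\mu,d_\nu)$ as $m\to\infty$, one has $t_m^{-1}\big(V_\alpha(\mu_m,\nu_m)-V_\alpha(\mu,\nu)\big)\to V_\alpha'(\mu,\nu;d_\mu,d_\nu)$. 2. Let $\xi_1,\xi_2,\dots$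 be i.i.d. with law $\mu$ and $\eta_1,\eta_2,\dots$ be i.i.d. with law $\nu$, the two sequences being independent of each other, and let $\mu_n$, $\nu_n$ be the empirical measures of $\xi_1,\dots,\xi_n$ and of $\eta_1,\dots,\eta_n$. Then $$\sqrt n\,\big(V_\alpha(\mu_n,\nu_n)-V_\alpha(\mu,\nu)\big)\ \longrightarrow\ V_\alpha'(\mu,\nu;Z_{\mathcal X},Z_{\mathcal Y})\quad\text{in distribution as } n\to\infty,$$ where $Z_{\mathcal X}$ and $Z_{\mathcal Y}$ are independent centred normal random vectors with covariance matrices $\Sigma_{\mathcal X}$ and $\Sigma_{\mathcal Y}$, where $\Sigma_{\mathcal X}(i,i)=\mu_i(1-\mu_i)$ and $\Sigma_{\mathcal X}(i,j)=-\mu_i\mu_j$ for $i\ne j$, and $\Sigma_{\mathcal Y}$ is defined in the same way from $\nu$. -/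

import Mathlib

open MeasureTheory ProbabilityTheory Filter Topology

noncomputable section

namespace MES

section Primal

variable {X Y : Type*} [Fintype X] [Fintype Y]

/-- The couplings of two vectors `μ` and `ν`: nonnegative matrices with row sums `μ` and column
sums `ν`. -/
def couplings (μ : X → ℝ) (ν : Y → ℝ) : Set (X → Y → ℝ) :=
  {π | (∀ i j, 0 ≤ π i j) ∧ (∀ i, ∑ j, π i j = μ i) ∧ ∀ j, ∑ i, π i j = ν j}

/-- The distribution function `x ↦ π(L ≤ x)` of the loss `L` under `π`. -/
def lossCDF (L π : X → Y → ℝ) (x : ℝ) : ℝ :=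
  ∑ i, ∑ j, if L i j ≤ x then π i j else 0

/-- The Value-at-Risk: the generalized inverse `inf {x : π(L ≤ x) ≥ u}` of the distribution
function. -/
def valueAtRisk (L π : X → Y → ℝ) (u : ℝ) : ℝ :=
  sInf {x : ℝ | u ≤ lossCDF L π x}

/-- The Expected Shortfall of the loss `L` under `π` at confidence level `α`. -/
def expectedShortfall (L : X → Y → ℝ) (α : ℝ) (π : X → Y → ℝ) : ℝ :=
  (1 - α)⁻¹ * ∫ u in α..1, valueAtRisk L π u

/-- The Maximum Expected Shortfall `V_α(μ, ν)`, the supremum of the Expected Shortfall over all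
couplings of `μ` and `ν`, as a function of the pair `p = (μ, ν)`. -/
def value (L : X → Y → ℝ) (α : ℝ) (p : (X → ℝ) × (Y → ℝ)) : ℝ :=
  sSup (expectedShortfall L α '' couplings p.1 p.2)

/-- The set `K` of all pairs of probability vectors. -/
def simplices (X Y : Type*) [Fintype X] [Fintype Y] : Set ((X → ℝ) × (Y → ℝ)) :=
  stdSimplex ℝ X ×ˢ stdSimplex ℝ Y

end Primal

section Dual

/-- The dual variables `(φ, ψ, ρ, β)`. -/
abbrev DualVar (X Y : Type*) : Type _ := (X → ℝ) × (Y → ℝ) × (X → Y → ℝ) × ℝ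

variable {X Y : Type*} [Fintype X] [Fintype Y]

/-- The feasible polyhedron of the dual linear program, with the normalization `φ x₀ = 0`. -/
def dualPolyhedron (L : X → Y → ℝ) (α : ℝ) (x₀ : X) : Set (DualVar X Y) :=
  {(φ, ψ, ρ, β) | (∀ i j, 0 ≤ (1 - α) * (φ i + ψ j) - ρ i j) ∧
    (∀ i j, L i j ≤ ρ i j + β) ∧ (∀ i j, 0 ≤ ρ i j) ∧ φ x₀ = 0}

/-- The extreme points `(φᵏ, ψᵏ, ρᵏ, βᵏ)` of the dual feasible polyhedron. -/
def dualVertices (L : X → Y → ℝ) (α : ℝ) (x₀ : X) : Set (DualVar X Y) :=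
  (dualPolyhedron L α x₀).extremePoints ℝ

/-- The linear form `φ · d_μ + ψ · d_ν` in the direction `d = (d_μ, d_ν)`. -/
def pairing (z : DualVar X Y) (d : (X → ℝ) × (Y → ℝ)) : ℝ :=
  ∑ i, z.1 i * d.1 i + ∑ j, z.2.1 j * d.2 j

/-- The dual objective `φ · μ + ψ · ν + β` at `p = (μ, ν)`. -/
def dualObjective (p : (X → ℝ) × (Y → ℝ)) (z : DualVar X Y) : ℝ :=
  pairing z p + z.2.2.2

/-- The set `I(μ, ν)` of the extreme points which attain the minimum of the dual objective over
all the extreme points. -/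
def optimalVertices (L : X → Y → ℝ) (α : ℝ) (x₀ : X) (p : (X → ℝ) × (Y → ℝ)) :
    Set (DualVar X Y) :=
  {z ∈ dualVertices L α x₀ | ∀ w ∈ dualVertices L α x₀, dualObjective p z ≤ dualObjective p w}

/-- `V'_α(μ, ν; d_μ, d_ν)`: the minimum of `φᵏ · d_μ + ψᵏ · d_ν` over `k ∈ I(μ, ν)`, where
`p = (μ, ν)` and `d = (d_μ, d_ν)`. -/
def valueDeriv (L : X → Y → ℝ) (α : ℝ) (x₀ : X) (p d : (X → ℝ) × (Y → ℝ)) : ℝ :=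
  sInf ((fun z => pairing z d) '' optimalVertices L α x₀ p)

end Dual

/-- `f` is Hadamard directionally differentiable at `u` tangentially to `K`, with directional
derivative `h ↦ f' h`: the difference quotients `(f (k n) - f u) / t n` converge to `f' h` whenever
`k n ∈ K`, `t n > 0`, `t n → 0` and `(k n - u) / t n → h`. -/
def HasHadamardDirDerivTangentially {E : Type*} [NormedAddCommGroup E] [NormedSpace ℝ E]
    (f : E → ℝ) (K : Set E) (u : E) (f' : E → ℝ) : Prop :=
  ∀ (k : ℕ → E) (t : ℕ → ℝ) (h : E), (∀ n, k n ∈ K) → (∀ n, 0 < t n) →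
    Tendsto t atTop (𝓝 0) → Tendsto (fun n => (t n)⁻¹ • (k n - u)) atTop (𝓝 h) →
    Tendsto (fun n => (f (k n) - f u) / t n) atTop (𝓝 (f' h))

section Sampling

variable {S : Type*} [DecidableEq S]

/-- The empirical measure, as a vector of frequencies, of the first `n` terms of the sample `ξ`. -/
def empirical (ξ : ℕ → S) (n : ℕ) : S → ℝ :=
  fun s => (∑ k ∈ Finset.range n, if ξ k = s then (1 : ℝ) else 0) / n

/-- The multinomial covariance matrix of the probability vector `μ`. -/
def multinomialCov (μ : S → ℝ) : Matrix S S ℝ :=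
  Matrix.of fun i j => if i = j then μ i * (1 - μ i) else -(μ i * μ j)

/-- `ξ 0, ξ 1, …` is a sequence of independent `S`-valued random variables on `(Ω, P)`, each with
law `μ`. -/
def IsRandomSample {Ω : Type*} [MeasurableSpace Ω] [MeasurableSpace S]
    (P : Measure Ω) (ξ : ℕ → Ω → S) (μ : S → ℝ) : Prop :=
  (∀ k, Measurable (ξ k)) ∧ (∀ k s, P.real (ξ k ⁻¹' {s}) = μ s) ∧ iIndepFun ξ P

end Sampling

end MES

end

/-! Everything rests on linear programming duality. By the Rockafellar–Uryasev formula, the Expected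
Shortfall is the minimum over β of β + (1 - α)⁻¹ E(L - β)⁺. Inserting a dual feasible point gives
weak duality (`expectedShortfall_le_dualObjective`). For strong duality (`exists_dual_of_lt`), write
a coupling as (1 - α) q + α r with q a tail scenario. The marginals and tail means of all such pairs
form a compact convex set, and a hyperplane separating it from ((μ, ν), v) yields a dual feasible
point with objective v.

The dual polyhedron contains no line and the objective is bounded below on it, so vertices suffice
(`Polyhedron.exists_extremePoint_le`). There are finitely many, hence on the simplices the value is
a minimum of finitely many affine functions (`isLeast_value`).

Near p only the vertices optimal at p compete, so the increment of the value equals the positively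
homogeneous, continuous function `valueDeriv` of k - p exactly, with no remainder
(`eventually_value_sub_eq`). Hadamard differentiability follows by rescaling. For the limit theorem,
the central limit theorem for the empirical measures is proved through characteristic functions and
mapped through `valueDeriv`; by the strong law, the local identity holds almost surely from some n
on. -/

/-! ### Vertices of polyhedra -/

namespace Polyhedron

variable {E ι : Type*} [AddCommGroup E] [Module ℝ E]

/-- The polyhedron `{z | b ≤ a z, e z = 0}` given by finitely many inequalities and an equation. -/
def carrier (a : ι → E →ₗ[ℝ] ℝ) (b : ι → ℝ) (e : E →ₗ[ℝ] ℝ) : Set E :=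
  {z | (∀ i, b i ≤ a i z) ∧ e z = 0}

/-- The inequalities which hold with equality at `z`. -/
def active (a : ι → E →ₗ[ℝ] ℝ) (b : ι → ℝ) (z : E) : Set ι := {i | a i z = b i}

variable {a : ι → E →ₗ[ℝ] ℝ} {b : ι → ℝ} {e : E →ₗ[ℝ] ℝ}

/-- An active form attains its minimum over the polyhedron at z, so it is constant on any segment of
the polyhedron with z in its interior. -/
theorem mem_extremePoints_of_active {z : E} (hz : z ∈ carrier a b e)
    (h : ∀ d, e d = 0 → (∀ i ∈ active a b z, a i d = 0) → d = 0) :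
    z ∈ (carrier a b e).extremePoints ℝ := by
  refine ⟨hz, fun x hx y hy hxy => ?_⟩
  obtain ⟨s, t, hs, ht, hst, rfl⟩ := hxy
  refine sub_eq_zero.1 (h _ ?_ fun i hi => ?_)
  · rw [map_sub, hx.2, hz.2, sub_zero]
  · have h1 := hx.1 i
    have h2 := hy.1 i
    have h3 : a i (s • x + t • y) = b i := hi
    rw [map_sub, h3]
    simp only [map_add, map_smul, smul_eq_mul] at h3
    obtain rfl : t = 1 - s := by linarith
    nlinarith

/-- The inactive inequalities have slack at z, so z + s d and z - s d are both feasible for small s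
> 0, with midpoint z. -/
theorem eq_zero_of_mem_extremePoints [Finite ι] {z : E}
    (hz : z ∈ (carrier a b e).extremePoints ℝ) {d : E} (hd : e d = 0)
    (h : ∀ i ∈ active a b z, a i d = 0) : d = 0 := by
  have key : ∀ d : E, e d = 0 → (∀ i ∈ active a b z, a i d = 0) →
      ∀ᶠ s : ℝ in 𝓝[>] 0, z + s • d ∈ carrier a b e := by
    intro d hd h
    have : ∀ i, ∀ᶠ s : ℝ in 𝓝[>] 0, b i ≤ a i (z + s • d) := by
      intro i
      by_cases hi : a i z = b i
      · refine .of_forall fun s => ?_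
        simp [h i hi, hi]
      · have hlt : b i < a i z := lt_of_le_of_ne (hz.1.1 i) (Ne.symm hi)
        have hc : Tendsto (fun s : ℝ => a i z + s * a i d) (𝓝 0) (𝓝 (a i z + 0 * a i d)) :=
          (Continuous.tendsto (by fun_prop) 0)
        rw [zero_mul, add_zero] at hc
        filter_upwards [nhdsWithin_le_nhds (hc.eventually_const_le hlt)] with s hs
        simpa using hs
    filter_upwards [eventually_all.2 this] with s hs
    exact ⟨hs, by simp [hd, hz.1.2]⟩
  have hpos : ∀ᶠ s : ℝ in 𝓝[>] 0, 0 < s := eventually_mem_nhdsWithin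
  obtain ⟨s, ⟨h1, h2⟩, h3⟩ := (((key d hd h).and
    (key (-d) (by simp [hd]) fun i hi => by simp [h i hi])).and hpos).exists
  have := hz.2 h1 h2 ⟨1 / 2, 1 / 2, by norm_num, by norm_num, by norm_num, by module⟩
  simpa [h3.ne'] using this

/-- An extreme point is determined by its set of active inequalities, because the difference of two
with the same set is annihilated by all active forms. -/
theorem finite_extremePoints [Finite ι] : ((carrier a b e).extremePoints ℝ).Finite := by
  refine Set.Finite.of_injOn (f := active a b) (t := Set.univ) (fun _ _ => Set.mem_univ _) ?_
    Set.finite_univ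
  intro z hz w hw hzw
  refine (sub_eq_zero.1 (eq_zero_of_mem_extremePoints hz (d := w - z) ?_ fun i hi => ?_)).symm
  · rw [map_sub, hw.1.2, hz.1.2, sub_zero]
  · have h1 : a i z = b i := hi
    have h2 : a i w = b i := by rw [hzw] at hi; exact hi
    rw [map_sub, h1, h2, sub_self]

/-- From a point of a polyhedron one can move along a direction which keeps the active
inequalities active, until a further inequality becomes active. -/
theorem exists_active_ssubset [Finite ι] {z : E} (hz : z ∈ carrier a b e) {d : E} (hd : e d = 0)
    (h : ∀ i ∈ active a b z, a i d = 0) (hneg : ∃ i, a i d < 0) :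
    ∃ t : ℝ, 0 ≤ t ∧ z + t • d ∈ carrier a b e ∧ active a b z ⊂ active a b (z + t • d) := by
  -- Ratio test: the step length is the first time at which a decreasing form reaches its bound.
  obtain ⟨j, hj, hmin⟩ := Set.exists_min_image {i | a i d < 0}
    (fun i => (a i z - b i) / -a i d) (Set.toFinite _) hneg
  have hj' : a j d < 0 := hj
  set t := (a j z - b j) / -a j d with ht
  have ht0 : 0 ≤ t := div_nonneg (sub_nonneg.2 (hz.1 j)) (by linarith)
  refine ⟨t, ht0, ⟨fun i => ?_, by simp [hd, hz.2]⟩, ?_⟩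
  · simp only [map_add, map_smul, smul_eq_mul]
    rcases lt_or_ge (a i d) 0 with hi | hi
    · have := hmin i hi
      rw [le_div_iff₀ (by linarith)] at this
      linarith
    · have := mul_nonneg ht0 hi
      linarith [hz.1 i]
  · refine (Set.ssubset_iff_of_subset fun i hi => ?_).2 ⟨j, ?_, fun hjz => hj'.ne (h j hjz)⟩
    · have h1 : a i z = b i := hi
      simp [active, h i hi, h1]
    · have hne := hj'.ne
      have : t * a j d = b j - a j z := by rw [ht]; field_simp; ring
      simp [active, this]

/-- A linear form which is bounded below on a polyhedron that contains no line does not exceed its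
value at a given point in some extreme point. -/
theorem exists_extremePoint_le [Finite ι] (hline : ∀ d, e d = 0 → (∀ i, a i d = 0) → d = 0)
    {c : E →ₗ[ℝ] ℝ} {m : ℝ} (hc : ∀ z ∈ carrier a b e, m ≤ c z) {z : E}
    (hz : z ∈ carrier a b e) : ∃ w ∈ (carrier a b e).extremePoints ℝ, c w ≤ c z := by
  -- Induction on the number of inactive inequalities: a point that is not extreme can be moved,
  -- without increasing c, until one more becomes active.
  induction hn : (active a b z)ᶜ.ncard using Nat.strong_induction_on generalizing z with
  | _ n ih =>
    by_cases hex : z ∈ (carrier a b e).extremePoints ℝ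
    · exact ⟨z, hex, le_rfl⟩
    obtain ⟨d, hd, hact, hd0⟩ : ∃ d, e d = 0 ∧ (∀ i ∈ active a b z, a i d = 0) ∧ d ≠ 0 := by
      by_contra! hcon
      exact hex (mem_extremePoints_of_active hz hcon)
    -- If c decreases along d and no form does, the whole ray is feasible; the parameter chosen
    -- below brings c down to m - 1.
    have key : ∀ d, e d = 0 → c d < 0 → ∃ i, a i d < 0 := by
      intro d hd hcd
      by_contra! hcon
      have hray : ∀ t : ℝ, 0 ≤ t → z + t • d ∈ carrier a b e := fun t ht =>
        ⟨fun i => by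
          have := mul_nonneg ht (hcon i)
          simp only [map_add, map_smul, smul_eq_mul]
          linarith [hz.1 i], by simp [hd, hz.2]⟩
      have h0 := hc _ hz
      have ht0 : 0 ≤ (c z - m + 1) / -c d := div_nonneg (by linarith) (by linarith)
      have := hc _ (hray _ ht0)
      have hne := hcd.ne
      have h2 : (c z - m + 1) / -c d * c d = -(c z - m + 1) := by field_simp
      simp only [map_add, map_smul, smul_eq_mul, h2] at this
      linarith
    -- The sign of d is free. If c d = 0, it is the absence of lines that makes some form decrease
    -- along d or -d.
    obtain ⟨d', hd', hact', hcd', hneg⟩ : ∃ d', e d' = 0 ∧ (∀ i ∈ active a b z, a i d' = 0) ∧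
        c d' ≤ 0 ∧ ∃ i, a i d' < 0 := by
      have hd2 : e (-d) = 0 := by simp [hd]
      have hact2 : ∀ i ∈ active a b z, a i (-d) = 0 := fun i hi => by simp [hact i hi]
      rcases lt_trichotomy (c d) 0 with h | h | h
      · exact ⟨d, hd, hact, h.le, key d hd h⟩
      · obtain ⟨i, hi⟩ : ∃ i, a i d ≠ 0 := by
          by_contra! hcon
          exact hd0 (hline d hd hcon)
        rcases lt_or_gt_of_ne hi with hi | hi
        · exact ⟨d, hd, hact, h.le, i, hi⟩
        · exact ⟨-d, hd2, hact2, by simp [h], i, by simpa using hi⟩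
      · exact ⟨-d, hd2, hact2, by simpa using h.le, key _ hd2 (by simpa using h)⟩
    obtain ⟨t, ht, hmem, hss⟩ := exists_active_ssubset hz hd' hact' hneg
    obtain ⟨w, hw, hle⟩ := ih _ (hn ▸ Set.ncard_lt_ncard (compl_lt_compl_iff_lt.2 hss)) hmem rfl
    refine ⟨w, hw, hle.trans ?_⟩
    have := mul_nonneg ht (neg_nonneg.2 hcd')
    simp only [map_add, map_smul, smul_eq_mul]
    linarith

end Polyhedron

/-! ### Expected Shortfall -/

namespace MES

variable {X Y : Type*} [Fintype X] [Fintype Y] {L π : X → Y → ℝ}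

theorem lossCDF_mono (h0 : ∀ i j, 0 ≤ π i j) : Monotone (lossCDF L π) := by
  intro x y hxy
  refine Finset.sum_le_sum fun i _ => Finset.sum_le_sum fun j _ => ?_
  split_ifs with h1 h2
  · exact le_rfl
  · exact absurd (h1.trans hxy) h2
  · exact h0 i j
  · exact le_rfl

theorem lossCDF_eventuallyEq (x : ℝ) : ∀ᶠ y in 𝓝[≥] x, lossCDF L π y = lossCDF L π x := by
  have : ∀ i j, ∀ᶠ y in 𝓝[≥] x, (L i j ≤ y ↔ L i j ≤ x) := by
    intro i j
    rcases le_or_gt (L i j) x with h | h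
    · filter_upwards [eventually_mem_nhdsWithin] with y hy
      exact ⟨fun _ => h, fun h => h.trans hy⟩
    · filter_upwards [nhdsWithin_le_nhds (eventually_lt_nhds h)] with y hy
      exact ⟨fun h' => absurd h' hy.not_ge, fun h' => absurd h' h.not_ge⟩
  filter_upwards [eventually_all.2 fun i => eventually_all.2 (this i)] with y hy
  simp [lossCDF, hy]

/-- The infimum is attained because the distribution function is constant just to the right of each
point. The bounds u ≤ 1 and u > 0 make the set nonempty and bounded below. -/
theorem valueAtRisk_le_iff (h0 : ∀ i j, 0 ≤ π i j) (h1 : ∑ i, ∑ j, π i j = 1) {u : ℝ}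
    (hu : u ∈ Set.Ioc (0 : ℝ) 1) (x : ℝ) : valueAtRisk L π u ≤ x ↔ u ≤ lossCDF L π x := by
  have hfin : (Set.range fun p : X × Y => L p.1 p.2).Finite := Set.finite_range _
  have hne : {x : ℝ | u ≤ lossCDF L π x}.Nonempty := by
    obtain ⟨M, hM⟩ := hfin.bddAbove
    refine ⟨M, ?_⟩
    have : ∀ i j, L i j ≤ M := fun i j => hM ⟨(i, j), rfl⟩
    simp [lossCDF, this, h1, hu.2]
  have hbdd : BddBelow {x : ℝ | u ≤ lossCDF L π x} := by
    obtain ⟨m, hm⟩ := hfin.bddBelow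
    refine ⟨m, fun x hx => ?_⟩
    by_contra! hlt
    have : ∀ i j, ¬ L i j ≤ x := fun i j => (hlt.trans_le (hm ⟨(i, j), rfl⟩)).not_ge
    have hx : u ≤ lossCDF L π x := hx
    simp only [lossCDF, this, if_false, Finset.sum_const_zero] at hx
    exact hu.1.not_ge hx
  refine ⟨fun h => ?_, fun h => csInf_le hbdd h⟩
  obtain ⟨y, hy, hy'⟩ :=
    (((isGLB_csInf hne hbdd).frequently_mem hne).and_eventually
      (lossCDF_eventuallyEq (L := L) (π := π) _)).exists
  have hy : u ≤ lossCDF L π y := hy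
  exact (hy.trans_eq hy').trans (lossCDF_mono h0 h)

theorem valueAtRisk_monotoneOn (h0 : ∀ i j, 0 ≤ π i j) (h1 : ∑ i, ∑ j, π i j = 1) :
    MonotoneOn (valueAtRisk L π) (Set.Ioc 0 1) := fun _ hu _ hv huv =>
  (valueAtRisk_le_iff h0 h1 hu _).2 (huv.trans ((valueAtRisk_le_iff h0 h1 hv _).1 le_rfl))

/-- The Value-at-Risk at a uniformly distributed level has the law of the loss. -/
theorem map_valueAtRisk (h0 : ∀ i j, 0 ≤ π i j) (h1 : ∑ i, ∑ j, π i j = 1) :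
    (volume.restrict (Set.Ioc (0 : ℝ) 1)).map (valueAtRisk L π) =
      ∑ i, ∑ j, ENNReal.ofReal (π i j) • Measure.dirac (L i j) := by
  have hae : AEMeasurable (valueAtRisk L π) (volume.restrict (Set.Ioc 0 1)) :=
    aemeasurable_restrict_of_monotoneOn measurableSet_Ioc (valueAtRisk_monotoneOn h0 h1)
  refine Measure.ext_of_Iic _ _ fun x => ?_
  have hle : lossCDF L π x ≤ 1 := by
    rw [← h1]
    refine Finset.sum_le_sum fun i _ => Finset.sum_le_sum fun j _ => ?_
    split_ifs
    exacts [le_rfl, h0 i j]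
  have hset : valueAtRisk L π ⁻¹' Set.Iic x ∩ Set.Ioc 0 1 = Set.Ioc 0 (lossCDF L π x) := by
    ext u
    constructor
    · rintro ⟨h, hu⟩
      exact ⟨hu.1, (valueAtRisk_le_iff h0 h1 hu x).1 h⟩
    · rintro ⟨hu, h⟩
      exact ⟨(valueAtRisk_le_iff h0 h1 ⟨hu, h.trans hle⟩ x).2 h, hu, h.trans hle⟩
  rw [Measure.map_apply_of_aemeasurable hae measurableSet_Iic,
    Measure.restrict_apply₀' measurableSet_Ioc.nullMeasurableSet, hset, Real.volume_Ioc, sub_zero,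
    lossCDF, ENNReal.ofReal_sum_of_nonneg
      (fun i _ => Finset.sum_nonneg fun j _ => by split_ifs; exacts [h0 i j, le_rfl])]
  simp only [Measure.coe_finsetSum, Finset.sum_apply, Measure.smul_apply, smul_eq_mul,
    Measure.dirac_apply' _ measurableSet_Iic]
  refine Finset.sum_congr rfl fun i _ => ?_
  rw [ENNReal.ofReal_sum_of_nonneg fun j _ => by split_ifs; exacts [h0 i j, le_rfl]]
  refine Finset.sum_congr rfl fun j _ => ?_
  by_cases h : L i j ≤ x <;> simp [h]

theorem integrable_loss_law (g : ℝ → ℝ) :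
    Integrable g (∑ i, ∑ j, ENNReal.ofReal (π i j) • Measure.dirac (L i j)) :=
  integrable_finsetSum_measure.2 fun _ _ => integrable_finsetSum_measure.2 fun _ _ =>
    (integrable_dirac (by simp)).smul_measure ENNReal.ofReal_ne_top

theorem integrableOn_comp_valueAtRisk (h0 : ∀ i j, 0 ≤ π i j) (h1 : ∑ i, ∑ j, π i j = 1)
    {g : ℝ → ℝ} (hg : Continuous g) :
    IntegrableOn (fun u => g (valueAtRisk L π u)) (Set.Ioc 0 1) := by
  have := integrable_loss_law (L := L) (π := π) g
  rw [← map_valueAtRisk h0 h1, integrable_map_measure hg.aestronglyMeasurable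
    (aemeasurable_restrict_of_monotoneOn measurableSet_Ioc (valueAtRisk_monotoneOn h0 h1))] at this
  exact this

theorem integral_comp_valueAtRisk (h0 : ∀ i j, 0 ≤ π i j) (h1 : ∑ i, ∑ j, π i j = 1)
    {g : ℝ → ℝ} (hg : Continuous g) :
    ∫ u in Set.Ioc 0 1, g (valueAtRisk L π u) = ∑ i, ∑ j, π i j * g (L i j) := by
  rw [← integral_map
    (aemeasurable_restrict_of_monotoneOn measurableSet_Ioc (valueAtRisk_monotoneOn h0 h1))
    hg.aestronglyMeasurable, map_valueAtRisk h0 h1, integral_finsetSum_measure]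
  · refine Finset.sum_congr rfl fun i _ => ?_
    rw [integral_finsetSum_measure]
    · exact Finset.sum_congr rfl fun j _ => by simp [h0 i j]
    · exact fun _ _ => (integrable_dirac (by simp)).smul_measure ENNReal.ofReal_ne_top
  · exact fun _ _ => integrable_finsetSum_measure.2 fun _ _ =>
      (integrable_dirac (by simp)).smul_measure ENNReal.ofReal_ne_top

variable {α : ℝ}

theorem expectedShortfall_eq_setIntegral (hα : α < 1) :
    expectedShortfall L α π = (1 - α)⁻¹ * ∫ u in Set.Ioc α 1, valueAtRisk L π u := by
  rw [expectedShortfall, intervalIntegral.integral_of_le hα.le]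

theorem setIntegral_add_excess (hα : α ∈ Set.Ioo (0 : ℝ) 1) (h0 : ∀ i j, 0 ≤ π i j)
    (h1 : ∑ i, ∑ j, π i j = 1) (β : ℝ) :
    (1 - α)⁻¹ * ∫ u in Set.Ioc α 1, (β + max (valueAtRisk L π u - β) 0) =
      β + (1 - α)⁻¹ * ∫ u in Set.Ioc α 1, max (valueAtRisk L π u - β) 0 := by
  have h : (1 - α) ≠ 0 := (sub_pos.2 hα.2).ne'
  rw [integral_add (by simp)
    ((integrableOn_comp_valueAtRisk (g := fun x => max (x - β) 0) h0 h1 (by fun_prop)).mono_set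
      (Set.Ioc_subset_Ioc_left hα.1.le))]
  simp [hα.2.le]
  field_simp

/-- The upper bound in the Rockafellar–Uryasev formula. -/
theorem expectedShortfall_le (hα : α ∈ Set.Ioo (0 : ℝ) 1) (h0 : ∀ i j, 0 ≤ π i j)
    (h1 : ∑ i, ∑ j, π i j = 1) (β : ℝ) :
    expectedShortfall L α π ≤ β + (1 - α)⁻¹ * ∑ i, ∑ j, π i j * max (L i j - β) 0 := by
  have hpos : 0 < 1 - α := sub_pos.2 hα.2
  have hsub : Set.Ioc α 1 ⊆ Set.Ioc 0 1 := Set.Ioc_subset_Ioc_left hα.1.le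
  have hi := integrableOn_comp_valueAtRisk (L := L) (g := fun x => max (x - β) 0) h0 h1
    (by fun_prop)
  rw [expectedShortfall_eq_setIntegral hα.2,
    ← integral_comp_valueAtRisk (g := fun x => max (x - β) 0) h0 h1 (by fun_prop)]
  -- Two losses: x ≤ β + (x - β)⁺, and then the nonnegative excess is integrated over all of (0, 1].
  calc _ ≤ (1 - α)⁻¹ * ∫ u in Set.Ioc α 1, (β + max (valueAtRisk L π u - β) 0) := by
        gcongr (1 - α)⁻¹ * ?_
        refine setIntegral_mono
          ((integrableOn_comp_valueAtRisk (g := id) h0 h1 continuous_id).mono_set hsub)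
          ((integrable_const β).add (hi.mono_set hsub)) fun u => ?_
        have := le_max_left (valueAtRisk L π u - β) 0
        dsimp only [id]
        linarith
    _ = _ := setIntegral_add_excess hα h0 h1 β
    _ ≤ _ := by
        gcongr β + (1 - α)⁻¹ * ?_
        exact setIntegral_mono_set hi (ae_of_all _ fun u => le_max_right _ _)
          (LE.le.eventuallyLE hsub)

/-- The Value-at-Risk attains the minimum in the Rockafellar–Uryasev formula. -/
theorem expectedShortfall_eq (hα : α ∈ Set.Ioo (0 : ℝ) 1) (h0 : ∀ i j, 0 ≤ π i j)
    (h1 : ∑ i, ∑ j, π i j = 1) :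
    expectedShortfall L α π = valueAtRisk L π α +
      (1 - α)⁻¹ * ∑ i, ∑ j, π i j * max (L i j - valueAtRisk L π α) 0 := by
  set β := valueAtRisk L π α
  have hmono := valueAtRisk_monotoneOn (L := L) h0 h1
  rw [expectedShortfall_eq_setIntegral hα.2,
    ← integral_comp_valueAtRisk (g := fun x => max (x - β) 0) h0 h1 (by fun_prop)]
  -- With β the quantile at α, monotonicity makes the excess vanish at levels up to α; above α it is
  -- the plain difference, so neither loss occurs.
  have hzero : ∫ u in Set.Ioc 0 1, max (valueAtRisk L π u - β) 0 =
      ∫ u in Set.Ioc α 1, max (valueAtRisk L π u - β) 0 := by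
    refine setIntegral_eq_of_subset_of_forall_sdiff_eq_zero measurableSet_Ioc
      (Set.Ioc_subset_Ioc_left hα.1.le) fun u hu => max_eq_right (sub_nonpos.2 ?_)
    refine hmono hu.1 ⟨hα.1, hα.2.le⟩ ?_
    by_contra! h
    exact hu.2 ⟨h, hu.1.2⟩
  rw [hzero, ← setIntegral_add_excess hα h0 h1]
  congr 1
  refine setIntegral_congr_fun measurableSet_Ioc fun u hu => ?_
  have : β ≤ valueAtRisk L π u :=
    hmono ⟨hα.1, hα.2.le⟩ ⟨hα.1.trans hu.1, hu.2⟩ hu.1.le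
  simp [max_eq_left (sub_nonneg.2 this)]

/-- The Expected Shortfall dominates the mean loss under every tail scenario. -/
theorem sum_le_expectedShortfall (hα : α ∈ Set.Ioo (0 : ℝ) 1) {q : X → Y → ℝ}
    (h0 : ∀ i j, 0 ≤ π i j) (h1 : ∑ i, ∑ j, π i j = 1) (hq0 : ∀ i j, 0 ≤ q i j)
    (hq1 : ∑ i, ∑ j, q i j = 1) (hqπ : ∀ i j, (1 - α) * q i j ≤ π i j) :
    ∑ i, ∑ j, q i j * L i j ≤ expectedShortfall L α π := by
  have hpos : 0 < 1 - α := sub_pos.2 hα.2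
  rw [expectedShortfall_eq hα h0 h1]
  set β := valueAtRisk L π α
  -- Since q has mass one, β can be distributed over it; it remains to compare termwise, using L ≤ β
  -- + (L - β)⁺ and q ≤ π / (1 - α).
  have h : β = ∑ i, ∑ j, q i j * β := by simp_rw [← Finset.sum_mul]; rw [hq1, one_mul]
  nth_rw 1 [h]
  simp_rw [Finset.mul_sum, ← Finset.sum_add_distrib]
  refine Finset.sum_le_sum fun i _ => Finset.sum_le_sum fun j _ => ?_
  have h2 : q i j ≤ (1 - α)⁻¹ * π i j := by
    rw [inv_mul_eq_div, le_div_iff₀ hpos]; linarith [hqπ i j]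
  have h3 := mul_le_mul_of_nonneg_right h2 (le_max_right (L i j - β) 0)
  have h4 := mul_le_mul_of_nonneg_left (le_max_left (L i j - β) 0) (hq0 i j)
  linarith

end MES

/-! ### Duality -/

namespace MES

variable {X Y : Type*} [Fintype X] [Fintype Y] {L : X → Y → ℝ} {α : ℝ}
  {μ : X → ℝ} {ν : Y → ℝ}

theorem sum_sum_eq_one_of_mem_couplings {π : X → Y → ℝ} (hπ : π ∈ couplings μ ν)
    (hμ : μ ∈ stdSimplex ℝ X) : ∑ i, ∑ j, π i j = 1 := by
  simp_rw [hπ.2.1]; exact hμ.2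

theorem sum_mul_add_eq_marginals (π : X → Y → ℝ) (f : X → ℝ) (g : Y → ℝ) :
    ∑ i, ∑ j, π i j * (f i + g j) = ∑ i, f i * ∑ j, π i j + ∑ j, g j * ∑ i, π i j := by
  simp_rw [mul_add, Finset.sum_add_distrib, Finset.mul_sum]
  congr 1
  · exact Finset.sum_congr rfl fun _ _ => Finset.sum_congr rfl fun _ _ => mul_comm _ _
  · rw [Finset.sum_comm]
    exact Finset.sum_congr rfl fun _ _ => Finset.sum_congr rfl fun _ _ => mul_comm _ _

theorem sum_mul_add_of_mem_couplings {π : X → Y → ℝ} (hπ : π ∈ couplings μ ν)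
    (f : X → ℝ) (g : Y → ℝ) :
    ∑ i, ∑ j, π i j * (f i + g j) = ∑ i, f i * μ i + ∑ j, g j * ν j := by
  simp_rw [sum_mul_add_eq_marginals, hπ.2.1, hπ.2.2]

/-- Weak duality: the constraints give (L - β)⁺ ≤ ρ ≤ (1 - α)(φ + ψ), and integrating φ + ψ against
a coupling sees only its marginals. -/
theorem expectedShortfall_le_dualObjective (hα : α ∈ Set.Ioo (0 : ℝ) 1) {x₀ : X}
    (hp : (μ, ν) ∈ simplices X Y) {π : X → Y → ℝ} (hπ : π ∈ couplings μ ν) {z : DualVar X Y}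
    (hz : z ∈ dualPolyhedron L α x₀) : expectedShortfall L α π ≤ dualObjective (μ, ν) z := by
  obtain ⟨φ, ψ, ρ, β⟩ := z
  obtain ⟨hz1, hz2, hz3, -⟩ := hz
  have hpos : 0 < 1 - α := sub_pos.2 hα.2
  refine (expectedShortfall_le hα hπ.1 (sum_sum_eq_one_of_mem_couplings hπ hp.1) β).trans ?_
  rw [dualObjective, pairing]
  dsimp only
  rw [← sum_mul_add_of_mem_couplings hπ, add_comm, Finset.mul_sum]
  simp_rw [Finset.mul_sum]
  refine add_le_add_left (Finset.sum_le_sum fun i _ => Finset.sum_le_sum fun j _ => ?_) β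
  rw [inv_mul_le_iff₀ hpos]
  have h1 : max (L i j - β) 0 ≤ (1 - α) * (φ i + ψ j) :=
    max_le (by linarith [hz1 i j, hz2 i j]) (by linarith [hz1 i j, hz3 i j])
  have := mul_le_mul_of_nonneg_left h1 (hπ.1 i j)
  linarith

/-- A coupling of the marginals of two scenarios `q` and `r`, and the tail mean of the loss. -/
def scenarioMap (L : X → Y → ℝ) (α : ℝ) :
    (X × Y → ℝ) × (X × Y → ℝ) →ₗ[ℝ] ((X → ℝ) × (Y → ℝ)) × ℝ where
  toFun s := ((fun i => ∑ j, ((1 - α) * s.1 (i, j) + α * s.2 (i, j)),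
    fun j => ∑ i, ((1 - α) * s.1 (i, j) + α * s.2 (i, j))), ∑ i, ∑ j, s.1 (i, j) * L i j)
  map_add' s t := by
    ext <;> simp [← Finset.sum_add_distrib, add_mul] <;>
      exact Finset.sum_congr rfl fun _ _ => by ring
  map_smul' c s := by
    ext <;> simp [Finset.mul_sum, mul_assoc]
    all_goals exact Finset.sum_congr rfl fun _ _ => by ring

theorem isCompact_image_scenarioMap (L : X → Y → ℝ) (α : ℝ) :
    IsCompact (scenarioMap L α '' (stdSimplex ℝ (X × Y) ×ˢ stdSimplex ℝ (X × Y))) :=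
  ((isCompact_stdSimplex ℝ _).prod (isCompact_stdSimplex ℝ _)).image
    (scenarioMap L α).continuous_of_finiteDimensional

theorem convex_image_scenarioMap (L : X → Y → ℝ) (α : ℝ) :
    Convex ℝ (scenarioMap L α '' (stdSimplex ℝ (X × Y) ×ˢ stdSimplex ℝ (X × Y))) :=
  ((convex_stdSimplex ℝ _).prod (convex_stdSimplex ℝ _)).linear_image _

theorem coupling_of_scenario (hα : α ∈ Set.Ioo (0 : ℝ) 1) {q r : X × Y → ℝ}
    (hq : q ∈ stdSimplex ℝ (X × Y)) (hr : r ∈ stdSimplex ℝ (X × Y)) {v : ℝ}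
    (hs : scenarioMap L α (q, r) = ((μ, ν), v)) :
    ∃ π ∈ couplings μ ν, (∀ i j, (1 - α) * q (i, j) ≤ π i j) := by
  have h1 := congrArg (fun z => z.1.1) hs
  have h2 := congrArg (fun z => z.1.2) hs
  have hpos : 0 < 1 - α := sub_pos.2 hα.2
  refine ⟨fun i j => (1 - α) * q (i, j) + α * r (i, j),
    ⟨fun i j => add_nonneg (mul_nonneg hpos.le (hq.1 _)) (mul_nonneg hα.1.le (hr.1 _)),
      fun i => congrFun h1 i, fun j => congrFun h2 j⟩, fun i j => ?_⟩
  linarith [mul_nonneg hα.1.le (hr.1 (i, j))]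

theorem prod_mem_stdSimplex (hp : (μ, ν) ∈ simplices X Y) :
    (fun x : X × Y => μ x.1 * ν x.2) ∈ stdSimplex ℝ (X × Y) := by
  refine ⟨fun x => mul_nonneg (hp.1.1 _) (hp.2.1 _), ?_⟩
  have h1 : ∑ i, μ i = 1 := hp.1.2
  have h2 : ∑ j, ν j = 1 := hp.2.2
  simp [Fintype.sum_prod_type, ← Finset.mul_sum, h1, h2]

theorem scenarioMap_prod (hp : (μ, ν) ∈ simplices X Y) :
    scenarioMap L α (fun x => μ x.1 * ν x.2, fun x => μ x.1 * ν x.2) =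
      ((μ, ν), ∑ i, ∑ j, μ i * ν j * L i j) := by
  have h1 : ∑ i, μ i = 1 := hp.1.2
  have h2 : ∑ j, ν j = 1 := hp.2.2
  ext i
  · simp [scenarioMap, ← add_mul, ← Finset.mul_sum, h2]
  · simp [scenarioMap, ← add_mul, ← Finset.mul_sum, ← Finset.sum_mul, h1]
  · rfl

theorem couplings_nonempty (hp : (μ, ν) ∈ simplices X Y) : (couplings μ ν).Nonempty := by
  have h1 : ∑ i, μ i = 1 := hp.1.2
  have h2 : ∑ j, ν j = 1 := hp.2.2
  exact ⟨fun i j => μ i * ν j, fun i j => mul_nonneg (hp.1.1 _) (hp.2.1 _),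
    fun i => by simp [← Finset.mul_sum, h2], fun j => by simp [← Finset.sum_mul, h1]⟩

/-- A linear functional which separates `((μ, ν), v)` from the scenarios, in coordinates. -/
theorem exists_separation (hp : (μ, ν) ∈ simplices X Y) {v : ℝ}
    (hprod : ∑ i, ∑ j, μ i * ν j * L i j ≤ v)
    (hv : ((μ, ν), v) ∉
      scenarioMap L α '' (stdSimplex ℝ (X × Y) ×ˢ stdSimplex ℝ (X × Y))) :
    ∃ (f : X → ℝ) (g : Y → ℝ), ∀ q ∈ stdSimplex ℝ (X × Y), ∀ r ∈ stdSimplex ℝ (X × Y),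
      (scenarioMap L α (q, r)).2 ≤ v + (∑ i, f i * (scenarioMap L α (q, r)).1.1 i +
        ∑ j, g j * (scenarioMap L α (q, r)).1.2 j) - (∑ i, f i * μ i + ∑ j, g j * ν j) := by
  classical
  obtain ⟨F, u, hF, hu⟩ := geometric_hahn_banach_closed_point
    (convex_image_scenarioMap L α) (isCompact_image_scenarioMap L α).isClosed hv
  obtain ⟨f, g, c, hFe⟩ : ∃ (f : X → ℝ) (g : Y → ℝ) (c : ℝ), ∀ m n s,
      F ((m, n), s) = ∑ i, f i * m i + ∑ j, g j * n j + c * s := by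
    refine ⟨fun i => F ((Pi.single i 1, 0), 0), fun j => F ((0, Pi.single j 1), 0),
      F ((0, 0), 1), fun m n s => ?_⟩
    have h : (((m, n), s) : ((X → ℝ) × (Y → ℝ)) × ℝ) =
        ∑ i, m i • (((Pi.single i 1, 0), 0) : ((X → ℝ) × (Y → ℝ)) × ℝ) +
        ∑ j, n j • (((0, Pi.single j 1), 0) : ((X → ℝ) × (Y → ℝ)) × ℝ) + s • ((0, 0), 1) := by
      ext i
      · simp [Prod.fst_sum, Finset.sum_apply, Pi.single_apply]
      · simp [Prod.fst_sum, Prod.snd_sum, Finset.sum_apply, Pi.single_apply]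
      · simp [Prod.snd_sum]
    conv_lhs => rw [h]
    simp only [map_add, map_sum, map_smul, smul_eq_mul, mul_comm]
  -- The hyperplane is not vertical: the product coupling gives a point of the image over the same
  -- (μ, ν) at height at most v.
  have hc : 0 < c := by
    have h1 := (hF _ ⟨(_, _), ⟨prod_mem_stdSimplex hp, prod_mem_stdSimplex hp⟩, rfl⟩).trans hu
    rw [scenarioMap_prod hp, hFe, hFe] at h1
    by_contra! hc
    have := mul_le_mul_of_nonpos_left hprod hc
    linarith
  refine ⟨fun i => -f i / c, fun j => -g j / c, fun q hq r hr => ?_⟩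
  have h1 := (hF _ ⟨(q, r), ⟨hq, hr⟩, rfl⟩).trans hu
  rw [hFe, ← Prod.mk.eta (p := scenarioMap L α (q, r)),
    ← Prod.mk.eta (p := (scenarioMap L α (q, r)).1), hFe] at h1
  simp only [div_mul_eq_mul_div, ← Finset.sum_div, neg_mul, Finset.sum_neg_distrib]
  field_simp
  linarith

/-- Strong duality: every number above the tail means of the couplings is the objective of some
dual feasible point. -/
theorem exists_dual_of_lt (hα : α ∈ Set.Ioo (0 : ℝ) 1) (x₀ : X)
    (hp : (μ, ν) ∈ simplices X Y) {v : ℝ}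
    (hv : ∀ π ∈ couplings μ ν, expectedShortfall L α π < v) :
    ∃ z ∈ dualPolyhedron L α x₀, dualObjective (μ, ν) z = v := by
  classical
  have hpos : 0 < 1 - α := sub_pos.2 hα.2
  have hlt : ∀ q ∈ stdSimplex ℝ (X × Y), ∀ r ∈ stdSimplex ℝ (X × Y), ∀ w,
      scenarioMap L α (q, r) = ((μ, ν), w) → w < v := by
    intro q hq r hr w hw
    obtain ⟨π, hπ, hqπ⟩ := coupling_of_scenario hα hq hr hw
    refine lt_of_le_of_lt ?_ (hv π hπ)
    have hw' : _ = w := congrArg Prod.snd hw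
    rw [← hw']
    exact sum_le_expectedShortfall (q := fun i j => q (i, j)) hα hπ.1
      (sum_sum_eq_one_of_mem_couplings hπ hp.1) (fun i j => hq.1 _)
      (by rw [← Fintype.sum_prod_type (f := q)]; exact hq.2) hqπ
  obtain ⟨f, g, hfg⟩ := exists_separation (L := L) (α := α) hp
    (hlt _ (prod_mem_stdSimplex hp) _ (prod_mem_stdSimplex hp) _ (scenarioMap_prod hp)).le
    (by rintro ⟨⟨q, r⟩, ⟨hq, hr⟩, h⟩; exact (hlt q hq r hr _ h).false)
  set γ := v - (∑ i, f i * μ i + ∑ j, g j * ν j) with hγ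
  -- Point masses for q and r turn the separation into pointwise inequalities.
  have hpt : ∀ i j k l, L i j ≤ (1 - α) * (f i + g j) + α * (f k + g l) + γ := by
    intro i j k l
    have := hfg _ (single_mem_stdSimplex ℝ (i, j)) _ (single_mem_stdSimplex ℝ (k, l))
    simp only [scenarioMap, LinearMap.coe_mk, AddHom.coe_mk, ← sum_mul_add_eq_marginals] at this
    simp only [Pi.single_apply, Prod.ext_iff, ite_and, add_mul, mul_ite, ite_mul, mul_one, mul_zero,
      one_mul, zero_mul, Finset.sum_add_distrib, Finset.sum_ite_eq', Finset.sum_ite_irrel,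
      Finset.sum_const_zero, Finset.mem_univ, if_true] at this
    linarith
  have : Nonempty (X × Y) := by
    by_contra! h
    have := (prod_mem_stdSimplex hp).2
    simp at this
  -- Putting r at the minimum m of f + g gives the sharpest bound, L ≤ (1 - α)(f + g - m) + (m + γ),
  -- whose summands are ρ ≥ 0 and β. The shift by f x₀ only normalizes φ.
  obtain ⟨⟨k, l⟩, hkl⟩ := Finite.exists_min fun x : X × Y => f x.1 + g x.2
  set m := f k + g l
  refine ⟨(fun i => f i - f x₀, fun j => g j + f x₀ - m,
    fun i j => (1 - α) * (f i + g j - m), m + γ),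
    ⟨fun i j => ?_, fun i j => ?_, fun i j => ?_, ?_⟩, ?_⟩
  · exact le_of_eq (by ring)
  · have := hpt i j k l
    dsimp only
    linarith
  · exact mul_nonneg hpos.le (sub_nonneg.2 (hkl (i, j)))
  · simp
  · have h1 : ∑ i, μ i = 1 := hp.1.2
    have h2 : ∑ j, ν j = 1 := hp.2.2
    simp only [dualObjective, pairing, sub_mul, add_mul, Finset.sum_sub_distrib,
      Finset.sum_add_distrib, ← Finset.mul_sum, h1, h2]
    linarith
end MES

/-! ### The value as a minimum over the dual vertices -/

namespace MES

section Constraints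

variable {X Y : Type*}

/-- The coordinate forms of the inequalities which define the dual polyhedron. -/
def dualForm (α : ℝ) : (X × Y) ⊕ (X × Y) ⊕ (X × Y) → DualVar X Y →ₗ[ℝ] ℝ
  | .inl p =>
    { toFun := fun z => (1 - α) * (z.1 p.1 + z.2.1 p.2) - z.2.2.1 p.1 p.2
      map_add' := fun z w => by simp; ring
      map_smul' := fun c z => by simp; ring }
  | .inr (.inl p) =>
    { toFun := fun z => z.2.2.1 p.1 p.2 + z.2.2.2
      map_add' := fun z w => by simp; ring
      map_smul' := fun c z => by simp; ring }
  | .inr (.inr p) =>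
    { toFun := fun z => z.2.2.1 p.1 p.2
      map_add' := fun z w => by simp
      map_smul' := fun c z => by simp }

/-- The right-hand sides of the inequalities which define the dual polyhedron. -/
def dualBound (L : X → Y → ℝ) : (X × Y) ⊕ (X × Y) ⊕ (X × Y) → ℝ
  | .inl _ => 0
  | .inr (.inl p) => L p.1 p.2
  | .inr (.inr _) => 0

/-- The normalization form `φ x₀`. -/
def normForm (x₀ : X) : DualVar X Y →ₗ[ℝ] ℝ where
  toFun z := z.1 x₀
  map_add' _ _ := rfl
  map_smul' _ _ := rfl

theorem dualPolyhedron_eq_carrier (L : X → Y → ℝ) (α : ℝ) (x₀ : X) :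
    dualPolyhedron L α x₀ = Polyhedron.carrier (dualForm α) (dualBound L) (normForm x₀) := by
  ext ⟨φ, ψ, ρ, β⟩
  simp [dualPolyhedron, Polyhedron.carrier, dualForm, dualBound, normForm, and_assoc]

/-- The dual polyhedron contains no line: the normalization excludes the one invariance, adding a
constant to φ and subtracting it from ψ. -/
theorem eq_zero_of_dualForm_eq_zero [Nonempty Y] {α : ℝ} (hα : α < 1) {x₀ : X}
    {d : DualVar X Y} (hd : normForm x₀ d = 0) (h : ∀ i, dualForm α i d = 0) : d = 0 := by
  obtain ⟨φ, ψ, ρ, β⟩ := d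
  have hpos : 0 < 1 - α := sub_pos.2 hα
  have h1 : ∀ i j, (1 - α) * (φ i + ψ j) - ρ i j = 0 := fun i j => h (.inl (i, j))
  have h2 : ∀ i j, ρ i j + β = 0 := fun i j => h (.inr (.inl (i, j)))
  have h3 : ∀ i j, ρ i j = 0 := fun i j => h (.inr (.inr (i, j)))
  have h4 : φ x₀ = 0 := hd
  have h5 : ∀ i j, φ i + ψ j = 0 := fun i j => by
    have := h1 i j
    rw [h3, sub_zero, mul_eq_zero] at this
    exact this.resolve_left hpos.ne'
  have hψ : ∀ j, ψ j = 0 := fun j => by simpa [h4] using h5 x₀ j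
  obtain ⟨j₀⟩ := ‹Nonempty Y›
  have hφ : ∀ i, φ i = 0 := fun i => by simpa [hψ] using h5 i j₀
  have hβ : β = 0 := by simpa [h3] using h2 x₀ j₀
  ext <;> simp [hφ, hψ, h3, hβ]

theorem finite_dualVertices [Finite X] [Finite Y] {L : X → Y → ℝ} {α : ℝ} {x₀ : X} :
    (dualVertices L α x₀).Finite := by
  rw [dualVertices, dualPolyhedron_eq_carrier]
  exact Polyhedron.finite_extremePoints

theorem dualPolyhedron_nonempty [Finite X] [Finite Y] {L : X → Y → ℝ} {α : ℝ} (hα : α < 1) (x₀ : X) :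
    (dualPolyhedron L α x₀).Nonempty := by
  obtain ⟨M, hM⟩ := (Set.finite_range fun p : X × Y => |L p.1 p.2|).bddAbove
  have hM' : ∀ i j, |L i j| ≤ M := fun i j => hM ⟨(i, j), rfl⟩
  have hpos : 1 - α ≠ 0 := (sub_pos.2 hα).ne'
  refine ⟨(0, fun _ => M / (1 - α), fun _ _ => M, 0), fun i j => ?_, fun i j => ?_, fun i j => ?_,
    rfl⟩
  · simp [mul_div_cancel₀ _ hpos]
  · simpa using (le_abs_self _).trans (hM' i j)
  · exact (abs_nonneg _).trans (hM' i j)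

end Constraints

variable {X Y : Type*} [Fintype X] [Fintype Y] {L : X → Y → ℝ} {α : ℝ} {x₀ : X}

theorem pairing_add_smul (z : DualVar X Y) (d e : (X → ℝ) × (Y → ℝ)) (c : ℝ) :
    pairing z (d + c • e) = pairing z d + c * pairing z e := by
  simp only [pairing, Prod.fst_add, Prod.snd_add, Prod.smul_fst, Prod.smul_snd, Pi.add_apply,
    Pi.smul_apply, smul_eq_mul, mul_add, Finset.sum_add_distrib, Finset.mul_sum]
  simp only [mul_left_comm c]
  ring

theorem pairing_sub (z : DualVar X Y) (d e : (X → ℝ) × (Y → ℝ)) :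
    pairing z (d - e) = pairing z d - pairing z e := by
  have := pairing_add_smul z d e (-1)
  rw [neg_one_smul, ← sub_eq_add_neg] at this
  linarith

theorem pairing_smul (z : DualVar X Y) (c : ℝ) (d : (X → ℝ) × (Y → ℝ)) :
    pairing z (c • d) = c * pairing z d := by
  have := pairing_add_smul z 0 d c
  rw [zero_add] at this
  simpa [pairing] using this

@[fun_prop]
theorem continuous_pairing (z : DualVar X Y) : Continuous (pairing z) := by
  unfold pairing
  fun_prop

@[fun_prop]
theorem continuous_dualObjective (z : DualVar X Y) : Continuous fun p => dualObjective p z := by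
  unfold dualObjective
  fun_prop

/-- The dual objective as a linear form in the dual variables. -/
def objectiveForm (p : (X → ℝ) × (Y → ℝ)) : DualVar X Y →ₗ[ℝ] ℝ where
  toFun := dualObjective p
  map_add' z w := by
    simp only [dualObjective, pairing, Prod.fst_add, Prod.snd_add, Pi.add_apply, add_mul,
      Finset.sum_add_distrib]
    ring
  map_smul' c z := by
    simp only [dualObjective, pairing, Prod.smul_fst, Prod.smul_snd, Pi.smul_apply, smul_eq_mul,
      mul_assoc, ← Finset.mul_sum, RingHom.id_apply]
    ring

/-- Weak duality against any one coupling supplies the lower bound needed to descend to a vertex. -/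
theorem exists_dualVertex_le (hα : α ∈ Set.Ioo (0 : ℝ) 1) {p : (X → ℝ) × (Y → ℝ)}
    (hp : p ∈ simplices X Y) {z : DualVar X Y} (hz : z ∈ dualPolyhedron L α x₀) :
    ∃ w ∈ dualVertices L α x₀, dualObjective p w ≤ dualObjective p z := by
  obtain ⟨π, hπ⟩ := couplings_nonempty (μ := p.1) (ν := p.2) hp
  have : Nonempty Y := by
    by_contra! h
    simpa using hp.2.2
  have hbdd : ∀ z ∈ dualPolyhedron L α x₀, expectedShortfall L α π ≤ objectiveForm p z :=
    fun z hz => expectedShortfall_le_dualObjective hα hp hπ hz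
  rw [dualPolyhedron_eq_carrier] at hz hbdd
  rw [dualVertices, dualPolyhedron_eq_carrier]
  exact Polyhedron.exists_extremePoint_le
    (fun d hd h => eq_zero_of_dualForm_eq_zero hα.2 hd h) hbdd hz

theorem isLeast_value (hα : α ∈ Set.Ioo (0 : ℝ) 1) (x₀ : X) {p : (X → ℝ) × (Y → ℝ)}
    (hp : p ∈ simplices X Y) :
    IsLeast (dualObjective p '' dualVertices L α x₀) (value L α p) := by
  have hne := (couplings_nonempty (μ := p.1) (ν := p.2) hp).image (expectedShortfall L α)
  have hle : ∀ z ∈ dualPolyhedron L α x₀, value L α p ≤ dualObjective p z := fun z hz =>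
    csSup_le hne (by rintro _ ⟨π, hπ, rfl⟩; exact expectedShortfall_le_dualObjective hα hp hπ hz)
  have hlt : ∀ v, value L α p < v → ∃ w ∈ dualVertices L α x₀, dualObjective p w ≤ v := by
    intro v hv
    have hbdd : BddAbove (expectedShortfall L α '' couplings p.1 p.2) := by
      obtain ⟨z, hz⟩ := dualPolyhedron_nonempty (L := L) hα.2 x₀
      exact ⟨dualObjective p z, by
        rintro _ ⟨π, hπ, rfl⟩; exact expectedShortfall_le_dualObjective hα hp hπ hz⟩
    obtain ⟨z, hz, rfl⟩ := exists_dual_of_lt hα x₀ (μ := p.1) (ν := p.2) hp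
      fun π hπ => (le_csSup hbdd ⟨π, hπ, rfl⟩).trans_lt hv
    exact exists_dualVertex_le hα hp hz
  obtain ⟨w₀, hw₀, -⟩ := hlt _ (lt_add_one _)
  obtain ⟨w, hw, hmin⟩ := Set.exists_min_image _ (dualObjective p)
    (finite_dualVertices (L := L) (α := α) (x₀ := x₀)) ⟨w₀, hw₀⟩
  have heq : value L α p = dualObjective p w := by
    -- Strong duality reaches only levels v strictly above the value; the best of the finitely many
    -- vertices lies below all of them.
    refine le_antisymm (hle w hw.1) (le_of_forall_gt_imp_ge_of_dense fun v hv => ?_)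
    obtain ⟨w', hw', h⟩ := hlt v hv
    exact (hmin w' hw').trans h
  refine ⟨⟨w, hw, heq.symm⟩, ?_⟩
  rintro _ ⟨z, hz, rfl⟩
  exact hle z hz.1

theorem value_eq_of_mem_optimalVertices (hα : α ∈ Set.Ioo (0 : ℝ) 1)
    {p : (X → ℝ) × (Y → ℝ)} (hp : p ∈ simplices X Y) {z : DualVar X Y}
    (hz : z ∈ optimalVertices L α x₀ p) : value L α p = dualObjective p z := by
  obtain ⟨⟨w, hw, h⟩, hle⟩ := isLeast_value (L := L) hα x₀ hp
  exact le_antisymm (hle ⟨z, hz.1, rfl⟩) (h ▸ hz.2 w hw)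

/-- Serves the measurability of the value at empirical measures, since `value` is controlled only on
the simplices. -/
theorem exists_continuous_eqOn_value (hα : α ∈ Set.Ioo (0 : ℝ) 1) [Nonempty X] :
    ∃ g : (X → ℝ) × (Y → ℝ) → ℝ, Continuous g ∧ Set.EqOn (value L α) g (simplices X Y) := by
  obtain ⟨x₀⟩ := ‹Nonempty X›
  have hfin := finite_dualVertices (L := L) (α := α) (x₀ := x₀)
  rcases (dualVertices L α x₀).eq_empty_or_nonempty with h | h
  · refine ⟨0, continuous_const, fun p hp => ?_⟩
    have := (isLeast_value (L := L) hα x₀ hp).1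
    simp [h] at this
  have hne : hfin.toFinset.Nonempty := by simpa using h
  refine ⟨fun p => hfin.toFinset.inf' hne (dualObjective p),
    Continuous.finset_inf'_apply hne fun z _ => continuous_dualObjective z, fun p hp => ?_⟩
  dsimp only
  rw [Finset.inf'_eq_csInf_image, Set.Finite.coe_toFinset]
  exact (isLeast_value hα x₀ hp).csInf_eq.symm

theorem optimalVertices_finite (p : (X → ℝ) × (Y → ℝ)) : (optimalVertices L α x₀ p).Finite :=
  finite_dualVertices.subset fun _ h => h.1

theorem optimalVertices_nonempty (hα : α ∈ Set.Ioo (0 : ℝ) 1) {p : (X → ℝ) × (Y → ℝ)}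
    (hp : p ∈ simplices X Y) : (optimalVertices L α x₀ p).Nonempty := by
  obtain ⟨⟨w, hw, h⟩, hle⟩ := isLeast_value (L := L) hα x₀ hp
  exact ⟨w, hw, fun z hz => h ▸ hle ⟨z, hz, rfl⟩⟩

theorem isLeast_valueDeriv (hα : α ∈ Set.Ioo (0 : ℝ) 1) {p : (X → ℝ) × (Y → ℝ)}
    (hp : p ∈ simplices X Y) (d : (X → ℝ) × (Y → ℝ)) :
    IsLeast ((fun z => pairing z d) '' optimalVertices L α x₀ p) (valueDeriv L α x₀ p d) :=
  ⟨((optimalVertices_nonempty hα hp).image _).csInf_mem ((optimalVertices_finite p).image _),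
    fun _ h => csInf_le ((optimalVertices_finite p).image _).bddBelow h⟩

theorem continuous_valueDeriv (hα : α ∈ Set.Ioo (0 : ℝ) 1) {p : (X → ℝ) × (Y → ℝ)}
    (hp : p ∈ simplices X Y) : Continuous (valueDeriv L α x₀ p) := by
  have hfin := optimalVertices_finite (L := L) (α := α) (x₀ := x₀) p
  have hne : hfin.toFinset.Nonempty := by
    simpa using optimalVertices_nonempty (L := L) (x₀ := x₀) hα hp
  have : valueDeriv L α x₀ p = fun d => hfin.toFinset.inf' hne fun z => pairing z d := by
    ext d
    rw [Finset.inf'_eq_csInf_image, Set.Finite.coe_toFinset, valueDeriv]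
  rw [this]
  exact Continuous.finset_inf'_apply hne fun z _ => continuous_pairing z

theorem valueDeriv_smul (hα : α ∈ Set.Ioo (0 : ℝ) 1) {p : (X → ℝ) × (Y → ℝ)}
    (hp : p ∈ simplices X Y) {c : ℝ} (hc : 0 ≤ c) (d : (X → ℝ) × (Y → ℝ)) :
    valueDeriv L α x₀ p (c • d) = c * valueDeriv L α x₀ p d := by
  obtain ⟨⟨w, hw, h⟩, hle⟩ := isLeast_valueDeriv (L := L) (x₀ := x₀) hα hp d
  refine (isLeast_valueDeriv hα hp (c • d)).unique ⟨⟨w, hw, ?_⟩, ?_⟩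
  · rw [← h]; exact pairing_smul w c d
  · rintro _ ⟨z, hz, rfl⟩
    dsimp only
    rw [pairing_smul]
    exact mul_le_mul_of_nonneg_left (hle ⟨z, hz, rfl⟩) hc

/-- Near `p`, the increments of the value coincide with its directional derivative. -/
theorem eventually_value_sub_eq (hα : α ∈ Set.Ioo (0 : ℝ) 1) (x₀ : X) {p : (X → ℝ) × (Y → ℝ)}
    (hp : p ∈ simplices X Y) : ∀ᶠ k in 𝓝 p, k ∈ simplices X Y →
      value L α k - value L α p = valueDeriv L α x₀ p (k - p) := by
  obtain ⟨z₀, hz₀⟩ := optimalVertices_nonempty (L := L) (x₀ := x₀) hα hp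
  -- A vertex not optimal at p loses strictly to z₀ there, hence also nearby by continuity.
  have hev : ∀ w ∈ dualVertices L α x₀, ∀ᶠ k in 𝓝 p, w ∉ optimalVertices L α x₀ p →
      dualObjective k z₀ < dualObjective k w := by
    intro w hw
    by_cases hwo : w ∈ optimalVertices L α x₀ p
    · exact .of_forall fun _ h => absurd hwo h
    have hlt : dualObjective p z₀ < dualObjective p w := by
      by_contra! h
      exact hwo ⟨hw, fun z hz => h.trans (hz₀.2 z hz)⟩
    filter_upwards [(continuous_dualObjective z₀).continuousAt.eventually_lt
      (continuous_dualObjective w).continuousAt hlt] with k hk _ using hk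
  filter_upwards [(finite_dualVertices.eventually_all).2 hev] with k hk hkK
  have hinc : ∀ z ∈ optimalVertices L α x₀ p,
      dualObjective k z - value L α p = pairing z (k - p) := by
    intro z hz
    rw [value_eq_of_mem_optimalVertices hα hp hz, pairing_sub, dualObjective, dualObjective]
    ring
  obtain ⟨⟨w, hw, hwk⟩, hle⟩ := isLeast_value (L := L) hα x₀ hkK
  have hwo : w ∈ optimalVertices L α x₀ p := by
    by_contra h
    exact (hk w hw h).not_ge (hwk ▸ hle ⟨z₀, hz₀.1, rfl⟩)
  refine ((isLeast_valueDeriv hα hp (k - p)).unique ⟨⟨w, hwo, ?_⟩, ?_⟩).symm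
  · rw [← hwk]; exact (hinc w hwo).symm
  · rintro _ ⟨z, hz, rfl⟩
    dsimp only
    rw [← hinc z hz]
    exact sub_le_sub_right (hle ⟨z, hz.1, rfl⟩) _

theorem hasHadamardDirDerivTangentially_value (hα : α ∈ Set.Ioo (0 : ℝ) 1) (x₀ : X)
    {p : (X → ℝ) × (Y → ℝ)} (hp : p ∈ simplices X Y) :
    HasHadamardDirDerivTangentially (value L α) (simplices X Y) p (valueDeriv L α x₀ p) := by
  intro k t h hk ht ht0 hh
  have hkp : Tendsto k atTop (𝓝 p) := by
    have h1 := (ht0.smul hh).add_const p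
    rw [zero_smul, zero_add] at h1
    refine h1.congr fun n => ?_
    rw [smul_inv_smul₀ (ht n).ne', sub_add_cancel]
  refine (((continuous_valueDeriv hα hp).tendsto h).comp hh).congr' ?_
  filter_upwards [hkp.eventually (eventually_value_sub_eq (L := L) hα x₀ hp)] with n hn
  rw [hn (hk n), Function.comp_apply, valueDeriv_smul hα hp (inv_nonneg.2 (ht n).le),
    inv_mul_eq_div]

end MES

/-! ### The central limit theorem for empirical measures -/

namespace MES

open WithLp Matrix

section Covariance

variable {S : Type*} [Fintype S] [DecidableEq S] {μ : S → ℝ}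

/-- The matrix is diag μ - μ μᵀ; its quadratic form at t is the variance of t under μ. -/
theorem dotProduct_multinomialCov (μ t : S → ℝ) :
    t ⬝ᵥ multinomialCov μ *ᵥ t = ∑ s, μ s * t s ^ 2 - (∑ s, μ s * t s) ^ 2 := by
  have h : multinomialCov μ = Matrix.diagonal μ - Matrix.vecMulVec μ μ := by
    ext i j
    by_cases hij : i = j
    · subst hij; simp [multinomialCov, Matrix.vecMulVec]; ring
    · simp [multinomialCov, Matrix.vecMulVec, hij]
  rw [h, Matrix.sub_mulVec, dotProduct_sub]
  congr 1
  · simp only [dotProduct, Matrix.mulVec_diagonal]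
    exact Finset.sum_congr rfl fun _ _ => by ring
  · have hc : t ⬝ᵥ μ = ∑ s, μ s * t s := dotProduct_comm t μ
    rw [Matrix.vecMulVec_mulVec, dotProduct_smul, hc, sq]
    rfl

theorem posSemidef_multinomialCov (hμ : μ ∈ stdSimplex ℝ S) : (multinomialCov μ).PosSemidef := by
  refine .of_dotProduct_mulVec_nonneg ?_ fun t => ?_
  · ext i j
    by_cases h : i = j
    · simp [multinomialCov, h]
    · simp [multinomialCov, h, Ne.symm h, mul_comm]
  · rw [star_trivial, dotProduct_multinomialCov]
    set m := ∑ s, μ s * t s with hm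
    have h1 : ∑ s, μ s = 1 := hμ.2
    have h2 : ∑ s, μ s * (t s - m) ^ 2 = ∑ s, μ s * t s ^ 2 - m ^ 2 := by
      have : ∀ s, μ s * (t s - m) ^ 2 = μ s * t s ^ 2 - 2 * m * (μ s * t s) + m ^ 2 * μ s :=
        fun s => by ring
      simp_rw [this, Finset.sum_add_distrib, Finset.sum_sub_distrib, ← Finset.mul_sum, h1, ← hm]
      ring
    rw [← h2]
    exact Finset.sum_nonneg fun s _ => mul_nonneg (hμ.1 s) (sq_nonneg _)

end Covariance

section Empirical

variable {S : Type*} [Fintype S] [DecidableEq S]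

/-- Projecting on t reduces the vector limit theorem to normalized sums of the scalars t (x k). For
n = 0 both sides are zero. -/
theorem inner_empirical (x : ℕ → S) (μ : S → ℝ) (n : ℕ) (t : EuclideanSpace ℝ S) :
    inner ℝ (toLp 2 (√(n : ℝ) • (empirical x n - μ))) t =
      (√(n : ℝ))⁻¹ * (∑ k ∈ Finset.range n, t (x k) - n * ∑ s, μ s * t s) := by
  have h : ∑ s, (∑ k ∈ Finset.range n, if x k = s then (1 : ℝ) else 0) * t s =
      ∑ k ∈ Finset.range n, t (x k) := by
    simp_rw [Finset.sum_mul]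
    rw [Finset.sum_comm]
    simp
  simp only [PiLp.inner_apply, RCLike.inner_apply, conj_trivial, Pi.smul_apply, Pi.sub_apply,
    smul_eq_mul, empirical]
  rcases Nat.eq_zero_or_pos n with rfl | hn
  · simp
  have hs : √(n : ℝ) * √(n : ℝ) = n := Real.mul_self_sqrt n.cast_nonneg
  have hn' : (n : ℝ) ≠ 0 := by positivity
  have hs' : √(n : ℝ) ≠ 0 := by positivity
  rw [← h, Finset.mul_sum, ← Finset.sum_sub_distrib, Finset.mul_sum]
  refine Finset.sum_congr rfl fun s _ => ?_
  generalize (∑ k ∈ Finset.range n, if x k = s then (1 : ℝ) else 0) = a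
  have hinv : (√(n : ℝ))⁻¹ = √(n : ℝ) / n := 
    inv_eq_of_mul_eq_one_right (by rw [← mul_div_assoc, hs, div_self hn'])
  rw [hinv]
  field_simp

theorem empirical_mem_stdSimplex (x : ℕ → S) {n : ℕ} (hn : n ≠ 0) :
    empirical x n ∈ stdSimplex ℝ S := by
  have hn' : (n : ℝ) ≠ 0 := by exact_mod_cast hn
  refine ⟨fun s => div_nonneg (Finset.sum_nonneg fun k _ => by split_ifs <;> simp) (by simp), ?_⟩
  simp only [empirical]
  rw [← Finset.sum_div, Finset.sum_comm]
  simp [hn']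

end Empirical

section Sample

/-- The Cramér–Wold device: a vector's characteristic function is read off from its scalar
projections at frequency 1. -/
theorem charFun_map_eq_charFun_map_inner {Ω E : Type*} [MeasurableSpace Ω] {P : Measure Ω}
    [NormedAddCommGroup E] [InnerProductSpace ℝ E] [MeasurableSpace E] [BorelSpace E]
    [SecondCountableTopology E] {G : Ω → E} (hG : AEMeasurable G P) (t : E) :
    charFun (P.map G) t = charFun (P.map fun ω => inner ℝ (G ω) t) (1 : ℝ) := by
  rw [charFun_apply, charFun_apply, integral_map hG (by fun_prop),
    integral_map (by fun_prop) (by fun_prop)]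
  simp

variable {S : Type*} [Fintype S] [MeasurableSpace S] [MeasurableSingletonClass S]
  {Ω : Type*} [MeasurableSpace Ω] {P : Measure Ω} [IsProbabilityMeasure P]
  {ξ : ℕ → Ω → S} {μ : S → ℝ}

theorem IsRandomSample.integral_comp (h : IsRandomSample P ξ μ) (k : ℕ) (f : S → ℝ) :
    ∫ ω, f (ξ k ω) ∂P = ∑ s, μ s * f s := by
  have := Measure.isProbabilityMeasure_map (μ := P) (h.1 k).aemeasurable
  rw [← integral_map (h.1 k).aemeasurable (Measurable.of_discrete (f := f)).aestronglyMeasurable,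
    integral_fintype .of_finite]
  refine Finset.sum_congr rfl fun s _ => ?_
  rw [map_measureReal_apply (h.1 k) (measurableSet_singleton s), h.2.1, smul_eq_mul]

theorem IsRandomSample.identDistrib (h : IsRandomSample P ξ μ) (k : ℕ) :
    IdentDistrib (ξ k) (ξ 0) P P := by
  refine ⟨(h.1 k).aemeasurable, (h.1 0).aemeasurable, Measure.ext_of_singleton fun s => ?_⟩
  rw [Measure.map_apply (h.1 k) (measurableSet_singleton s),
    Measure.map_apply (h.1 0) (measurableSet_singleton s),
    ← measureReal_eq_measureReal_iff, h.2.1, h.2.1]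

theorem IsRandomSample.memLp_comp (h : IsRandomSample P ξ μ) (k : ℕ) (f : S → ℝ)
    (p : ENNReal) : MemLp (fun ω => f (ξ k ω)) p P := by
  have := Measure.isProbabilityMeasure_map (μ := P) (h.1 k).aemeasurable
  exact (memLp_map_measure_iff (Measurable.of_discrete (f := f)).aestronglyMeasurable
    (h.1 k).aemeasurable).1 .of_discrete

variable [DecidableEq S]

theorem IsRandomSample.variance_comp (h : IsRandomSample P ξ μ) (f : S → ℝ) :
    Var[fun ω => f (ξ 0 ω); P] = f ⬝ᵥ multinomialCov μ *ᵥ f := by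
  rw [variance_eq_sub (h.memLp_comp 0 f 2), dotProduct_multinomialCov, h.integral_comp]
  congr 1
  exact h.integral_comp 0 fun s => f s ^ 2

theorem measurable_empirical (n : ℕ) : Measurable fun x : ℕ → S => empirical x n := by
  refine measurable_pi_lambda _ fun s => Measurable.div_const ?_ _
  refine Finset.measurable_sum _ fun k _ => ?_
  exact (Measurable.of_discrete (f := fun y : S => if y = s then (1 : ℝ) else 0)).comp
    (measurable_pi_apply k)

theorem measurable_toLp_empirical (μ : S → ℝ) (n : ℕ) :
    Measurable fun x : ℕ → S => toLp 2 (√(n : ℝ) • (empirical x n - μ)) := by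
  have := measurable_empirical (S := S) n
  exact (PiLp.continuous_toLp 2 _).measurable.comp (by fun_prop)

/-- The strong law for the indicator of each of the finitely many points. -/
theorem IsRandomSample.ae_tendsto_empirical (h : IsRandomSample P ξ μ) :
    ∀ᵐ ω ∂P, Tendsto (fun n => empirical (fun k => ξ k ω) n) atTop (𝓝 μ) := by
  have : ∀ s, ∀ᵐ ω ∂P, Tendsto (fun n => empirical (fun k => ξ k ω) n s) atTop (𝓝 (μ s)) := by
    intro s
    let f : S → ℝ := fun y => if y = s then 1 else 0
    have hf : Measurable f := .of_discrete
    have h1 := strong_law_ae_real (μ := P) (fun k ω => f (ξ k ω)) ?_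
      (fun i j hij => (h.2.2.indepFun hij).comp hf hf) fun k => (h.identDistrib k).comp hf
    · rw [h.integral_comp] at h1
      simpa [f, empirical] using h1
    · exact memLp_one_iff_integrable.1 (h.memLp_comp 0 f 1)
  filter_upwards [ae_all_iff.2 this] with ω hω
  exact tendsto_pi_nhds.2 hω

/-- The central limit theorem for empirical measures, in terms of characteristic functions. -/
theorem IsRandomSample.tendsto_charFun (h : IsRandomSample P ξ μ) (hμ : μ ∈ stdSimplex ℝ S)
    (t : EuclideanSpace ℝ S) :
    Tendsto (fun n : ℕ => charFun
      (P.map fun ω => toLp 2 (√(n : ℝ) • (empirical (fun k => ξ k ω) n - μ))) t) atTop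
      (𝓝 (charFun (multivariateGaussian 0 (multinomialCov μ)) t)) := by
  have ht : Measurable t.ofLp := .of_discrete
  have hclt := tendstoInDistribution_inv_sqrt_mul_sum_sub (P := P)
    (X := fun k ω => t (ξ k ω)) (Y := id)
    (P' := gaussianReal 0 Var[fun ω => t (ξ 0 ω); P].toNNReal) .id ?_
    (h.2.2.comp (fun _ => t.ofLp) fun _ => ht) fun k => (h.identDistrib k).comp ht
  · have h1 := ProbabilityMeasure.tendsto_iff_tendsto_charFun.1 hclt.tendsto 1
    simp only [ProbabilityMeasure.coe_mk, Measure.map_id, charFun_gaussianReal,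
      h.variance_comp] at h1
    rw [charFun_multivariateGaussian (posSemidef_multinomialCov hμ)]
    have hvar : 0 ≤ t.ofLp ⬝ᵥ multinomialCov μ *ᵥ t.ofLp := by
      rw [← h.variance_comp]; exact variance_nonneg _ _
    refine Tendsto.congr' (.of_forall fun n => ?_) (h1.trans (le_of_eq ?_))
    · have hG := (measurable_toLp_empirical μ n).comp (measurable_pi_lambda _ h.1)
      refine Eq.trans ?_ (charFun_map_eq_charFun_map_inner hG.aemeasurable t).symm
      congr 3
      ext ω
      rw [Function.comp_apply, inner_empirical, ← h.integral_comp 0 t.ofLp]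
    · simp [Real.coe_toNNReal _ hvar]
  · exact h.memLp_comp 0 t.ofLp 2

end Sample

end MES

namespace MES

open WithLp

/-- Pairs of independent random vectors converge in distribution to a pair of independent random
vectors if the characteristic functions of the components converge. -/
theorem tendstoInDistribution_toLp_of_charFun {E F Ω Ω' : Type*} [MeasurableSpace Ω]
    {P : Measure Ω} [IsProbabilityMeasure P] [MeasurableSpace Ω'] {P' : Measure Ω'}
    [IsProbabilityMeasure P'] [NormedAddCommGroup E] [InnerProductSpace ℝ E]
    [FiniteDimensional ℝ E] [MeasurableSpace E] [BorelSpace E] [NormedAddCommGroup F]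
    [InnerProductSpace ℝ F] [FiniteDimensional ℝ F] [MeasurableSpace F] [BorelSpace F]
    {G : ℕ → Ω → E} {H : ℕ → Ω → F} {Z : Ω' → E} {W : Ω' → F}
    (hG : ∀ n, AEMeasurable (G n) P) (hH : ∀ n, AEMeasurable (H n) P)
    (hZ : AEMeasurable Z P') (hW : AEMeasurable W P') (hGH : ∀ n, IndepFun (G n) (H n) P)
    (hZW : IndepFun Z W P')
    (hGZ : ∀ t, Tendsto (fun n => charFun (P.map (G n)) t) atTop (𝓝 (charFun (P'.map Z) t)))
    (hHW : ∀ t, Tendsto (fun n => charFun (P.map (H n)) t) atTop (𝓝 (charFun (P'.map W) t))) :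
    TendstoInDistribution (fun n ω => toLp 2 (G n ω, H n ω)) atTop
      (fun ω' => toLp 2 (Z ω', W ω')) (fun _ => P) P' := by
  have : CompleteSpace E := FiniteDimensional.complete ℝ E
  have : CompleteSpace F := FiniteDimensional.complete ℝ F
  have : SecondCountableTopology E :=
    have := FiniteDimensional.proper_real E; inferInstance
  have : SecondCountableTopology F :=
    have := FiniteDimensional.proper_real F; inferInstance
  refine ⟨fun n => ?_, by fun_prop, ProbabilityMeasure.tendsto_iff_tendsto_charFun.2 fun t => ?_⟩
  · have h1 := hG n
    have h2 := hH n
    fun_prop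
  · simp only [ProbabilityMeasure.coe_mk]
    -- Independence factors the joint characteristic functions, so the two limits multiply.
    rw [(indepFun_iff_charFun_prod hZ hW).1 hZW t]
    exact ((hGZ _).mul (hHW _)).congr fun n =>
      ((indepFun_iff_charFun_prod (hG n) (hH n)).1 (hGH n) t).symm

variable {X Y : Type*} [Fintype X] [Fintype Y] [DecidableEq X] [DecidableEq Y]
  [MeasurableSpace X] [MeasurableSingletonClass X] [MeasurableSpace Y]
  [MeasurableSingletonClass Y] {L : X → Y → ℝ} {α : ℝ} {x₀ : X} {μ : X → ℝ} {ν : Y → ℝ}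
  {Ω : Type*} [MeasurableSpace Ω] {P : Measure Ω} [IsProbabilityMeasure P]
  {ξ : ℕ → Ω → X} {η : ℕ → Ω → Y}
  {Ω' : Type*} [MeasurableSpace Ω'] {P' : Measure Ω'} [IsProbabilityMeasure P']
  {ZX : Ω' → EuclideanSpace ℝ X} {ZY : Ω' → EuclideanSpace ℝ Y}

/-- The joint central limit theorem for the two empirical measures. -/
theorem tendstoInDistribution_empirical (hμ : μ ∈ stdSimplex ℝ X) (hν : ν ∈ stdSimplex ℝ Y)
    (hξ : IsRandomSample P ξ μ) (hη : IsRandomSample P η ν)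
    (hξη : IndepFun (fun ω k => ξ k ω) (fun ω k => η k ω) P)
    (hZX : HasLaw ZX (multivariateGaussian 0 (multinomialCov μ)) P')
    (hZY : HasLaw ZY (multivariateGaussian 0 (multinomialCov ν)) P') (hZ : IndepFun ZX ZY P') :
    TendstoInDistribution
      (fun (n : ℕ) ω => toLp 2
        (toLp 2 (√(n : ℝ) • (empirical (fun k => ξ k ω) n - μ)),
          toLp 2 (√(n : ℝ) • (empirical (fun k => η k ω) n - ν))))
      atTop (fun ω' => toLp 2 (ZX ω', ZY ω')) (fun _ => P) P' := by
  have hX := fun n => (measurable_toLp_empirical μ n).comp (measurable_pi_lambda _ hξ.1)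
  have hY := fun n => (measurable_toLp_empirical ν n).comp (measurable_pi_lambda _ hη.1)
  refine tendstoInDistribution_toLp_of_charFun (fun n => (hX n).aemeasurable)
    (fun n => (hY n).aemeasurable) hZX.aemeasurable hZY.aemeasurable
    (fun n => hξη.comp (measurable_toLp_empirical μ n) (measurable_toLp_empirical ν n)) hZ
    (fun t => ?_) fun t => ?_
  · rw [hZX.map_eq]
    exact hξ.tendsto_charFun hμ t
  · rw [hZY.map_eq]
    exact hη.tendsto_charFun hν t

/-- The delta method for the value at the empirical measures. -/
theorem tendstoInDistribution_value (hα : α ∈ Set.Ioo (0 : ℝ) 1) (x₀ : X)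
    (hp : (μ, ν) ∈ simplices X Y)
    (hξ : IsRandomSample P ξ μ) (hη : IsRandomSample P η ν)
    (hξη : IndepFun (fun ω k => ξ k ω) (fun ω k => η k ω) P)
    (hZX : HasLaw ZX (multivariateGaussian 0 (multinomialCov μ)) P')
    (hZY : HasLaw ZY (multivariateGaussian 0 (multinomialCov ν)) P') (hZ : IndepFun ZX ZY P') :
    TendstoInDistribution
      (fun (n : ℕ) ω => √(n : ℝ) *
        (value L α (empirical (fun k => ξ k ω) n, empirical (fun k => η k ω) n) -
          value L α (μ, ν)))
      atTop (fun ω' => valueDeriv L α x₀ (μ, ν) ((ZX ω').ofLp, (ZY ω').ofLp))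
      (fun _ => P) P' := by
  have hcont := continuous_valueDeriv (L := L) (x₀ := x₀) hα hp
  have hlim := (tendstoInDistribution_empirical hp.1 hp.2 hξ hη hξη hZX hZY hZ).continuous_comp
    (g := fun w => valueDeriv L α x₀ (μ, ν) (w.fst.ofLp, w.snd.ofLp))
    (hcont.comp (by fun_prop))
  have hmem : ∀ n : ℕ, n ≠ 0 → ∀ ω,
      (empirical (fun k => ξ k ω) n, empirical (fun k => η k ω) n) ∈ simplices X Y :=
    fun n hn ω => ⟨empirical_mem_stdSimplex _ hn, empirical_mem_stdSimplex _ hn⟩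
  have hmeas : ∀ n : ℕ, AEMeasurable (fun ω => √(n : ℝ) *
      (value L α (empirical (fun k => ξ k ω) n, empirical (fun k => η k ω) n) -
        value L α (μ, ν))) P := by
    intro n
    -- The empirical vector of an empty sample is zero, outside the simplex; the factor √0 disposes
    -- of this case.
    rcases eq_or_ne n 0 with rfl | hn
    · simp
    have : Nonempty X := ⟨x₀⟩
    obtain ⟨g, hg, hgV⟩ := exists_continuous_eqOn_value (L := L) (X := X) (Y := Y) hα
    have h1 := (measurable_empirical n).comp (measurable_pi_lambda _ hξ.1)
    have h2 := (measurable_empirical n).comp (measurable_pi_lambda _ hη.1)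
    simp_rw [fun ω => hgV (hmem n hn ω)]
    exact (((hg.measurable.comp (h1.prodMk h2)).sub_const _).const_mul _).aemeasurable
  -- Slutsky: the difference from `valueDeriv` of the rescaled fluctuation is almost surely zero for
  -- all large n, by the local identity and homogeneity with factor √n.
  refine tendstoInDistribution_of_tendstoInMeasure_sub _ _ hlim ?_ hmeas
  refine tendstoInMeasure_of_tendsto_ae
    (fun n => ((hmeas n).sub (hlim.forall_aemeasurable n)).aestronglyMeasurable) ?_
  filter_upwards [hξ.ae_tendsto_empirical, hη.ae_tendsto_empirical] with ω h1 h2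
  refine tendsto_const_nhds.congr' ?_
  filter_upwards [(h1.prodMk_nhds h2).eventually (eventually_value_sub_eq (L := L) hα x₀ hp),
    eventually_ne_atTop 0] with n hn hn0
  have hsm := valueDeriv_smul (L := L) (x₀ := x₀) hα hp (Real.sqrt_nonneg n)
    ((empirical (fun k => ξ k ω) n, empirical (fun k => η k ω) n) - (μ, ν))
  rw [← hn (hmem n hn0 ω)] at hsm
  simp only [Pi.sub_apply, Pi.zero_apply]
  exact (sub_eq_zero.2 hsm.symm).symm

end MES

theorem mainTheorem4 {X Y : Type*} [Fintype X] [Fintype Y] [DecidableEq X] [DecidableEq Y]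
    [MeasurableSpace X] [MeasurableSingletonClass X]
    [MeasurableSpace Y] [MeasurableSingletonClass Y]
    (L : X → Y → ℝ) (α : ℝ) (hα : α ∈ Set.Ioo (0 : ℝ) 1) (x₀ : X) :
    -- the dual polyhedron has finitely many extreme points
    (MES.dualVertices L α x₀).Finite ∧
    ∀ (μ : X → ℝ) (ν : Y → ℝ), (μ, ν) ∈ MES.simplices X Y →
      -- the value is the minimum of the dual objective over the extreme points
      IsLeast (MES.dualObjective (μ, ν) '' MES.dualVertices L α x₀) (MES.value L α (μ, ν)) ∧
      -- the minimum in the formula for the derivative is attained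
      (∀ d : (X → ℝ) × (Y → ℝ),
        IsLeast ((fun z => MES.pairing z d) '' MES.optimalVertices L α x₀ (μ, ν))
          (MES.valueDeriv L α x₀ (μ, ν) d)) ∧
      -- Hadamard directional differentiability, tangentially to the product of simplices
      MES.HasHadamardDirDerivTangentially (MES.value L α) (MES.simplices X Y) (μ, ν)
        (MES.valueDeriv L α x₀ (μ, ν)) ∧
      -- the limit theorem for empirical measures
      ∀ (Ω : Type*) [MeasurableSpace Ω] (P : Measure Ω) [IsProbabilityMeasure P]
        (ξ : ℕ → Ω → X) (η : ℕ → Ω → Y)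
        (Ω' : Type*) [MeasurableSpace Ω'] (P' : Measure Ω') [IsProbabilityMeasure P']
        (ZX : Ω' → EuclideanSpace ℝ X) (ZY : Ω' → EuclideanSpace ℝ Y),
        MES.IsRandomSample P ξ μ → MES.IsRandomSample P η ν →
        IndepFun (fun ω k => ξ k ω) (fun ω k => η k ω) P →
        HasLaw ZX (multivariateGaussian 0 (MES.multinomialCov μ)) P' →
        HasLaw ZY (multivariateGaussian 0 (MES.multinomialCov ν)) P' →
        IndepFun ZX ZY P' →
        TendstoInDistribution
          (fun (n : ℕ) ω => √(n : ℝ) *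
            (MES.value L α (MES.empirical (fun k => ξ k ω) n, MES.empirical (fun k => η k ω) n) -
              MES.value L α (μ, ν)))
          atTop
          (fun ω' => MES.valueDeriv L α x₀ (μ, ν) ((ZX ω').ofLp, (ZY ω').ofLp))
          (fun _ => P) P' :=
  ⟨MES.finite_dualVertices, fun _ _ hp => ⟨MES.isLeast_value hα x₀ hp,
    MES.isLeast_valueDeriv hα hp, MES.hasHadamardDirDerivTangentially_value hα x₀ hp,
    fun _ _ _ _ _ _ _ _ _ _ _ _ hξ hη hξη hZX hZY hZ =>
      MES.tendstoInDistribution_value hα x₀ hp hξ hη hξη hZX hZY hZ⟩⟩
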